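/- Let $n \ge 0$, let $[n]=\{1,\dots,n\}$, and let $[n']=\{1',\dots,n'\}$ be a disjoint copy of $[n]$. Let $w$ be an $n\times n$ partial permutation matrix, i.e. a $0/1$ matrix with at most one $1$ in each row and each column, and let $S(w)=\{(i,j) : w_{ij}=1\}$. *Matrix Schubert ideal.* Let $B\subset GL_n(\mathbb{C})$ be the group of invertible upper triangular matrices, let $X_w=\overline{B^T w B}\subseteq\mathbb{C}^{n\times n}$ be the Zariski closure of $\{b^T w c : b,c\in B\}$, and let $I_w\subseteq\mathbb{C}[\sigma_{ij} : i\in[n],\, j\in[n']]$ be the vanishing ideal of $X_w$. *The DAG $G(w)$.* It has vertex set $[n]\cup[n']\cup S(w)$ and the edges $k\to l$ for $k<l$ in $[n]$; $k'\to l'$ for $k'<l'$ in $[n']$; and, for each $(i,j)\in S(w)$, $(i,j)\to k$ for all $k\in[n]$ with $k\ge i$ and $(i,j)\to k'$ for all $k'\in[n']$ with $k\ge j$. *Ideals of Gaussian Bayesian networks.* For a finite DAG $G$ with vertex set $V$, a trek from $u$ to $v$ is a simple path $P$ from $u$ to $v$ (edges may be traversed in either direction) containing no collider, i.e. no two distinct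 edges $i\to k$, $j\to k$ with the same head; it has a unique topmost vertex $\mathrm{top}(P)$. Let $T(u,v)$ be the set of treks from $u$ to $v$ ($T(u,u)$ consists of the empty trek). Let $\mathbb{C}[\sigma_{uv} : u,v\in V]$ be the polynomial ring with $\sigma_{uv}=\sigma_{vu}$, let $\mathbb{C}[a,\lambda]$ be the polynomial ring with one indeterminate $a_v$ for each vertex $v$ and one indeterminate $\lambda_{kl}$ for each edge $k\to l$, and let $$\phi_G:\mathbb{C}[\sigma_{uv} : u,v\in V]\to\mathbb{C}[a,\lambda],\qquad \sigma_{uv}\mapsto\sum_{P\in T(u,v)}a_{\mathrm{top}(P)}\prod_{k\to l\in P}\lambda_{kl}.$$ Put $I_G=\ker\phi_G$ and, for a set $O\subseteq V$ of observed vertices, $I_{G,O}=I_G\cap\mathbb{C}[\sigma_{uv} : u,v\in O]$. **Theorem.** With observed vertices $[n]\cup[n']$, $$I_w\cdot\mathbb{C}[\sigma_{ij} : i,j\in[n]\cup[n']]=I_{G(w),[n]\cup[n']}.$$ -/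

import Mathlib

noncomputable section

/-- A directed acyclic graph on the vertex set `V`. -/
structure DAG (V : Type*) extends Digraph V where
  acyclic : ∀ v, ¬ Relation.TransGen Adj v v

namespace DAG

variable {V : Type*} (G : DAG V)

theorem ne_of_adj {u v : V} (h : G.Adj u v) : u ≠ v := by
  rintro rfl
  exact G.acyclic u (.single h)

theorem asymm {u v : V} (h : G.Adj u v) : ¬ G.Adj v u :=
  fun h' => G.acyclic u (.tail (.single h) h')

/-- The underlying undirected graph of `G`. -/
def skeleton : SimpleGraph V where
  Adj u v := G.Adj u v ∨ G.Adj v u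
  symm := ⟨fun _ _ h => h.symm⟩
  loopless := ⟨fun _ h => h.elim (fun h => G.ne_of_adj h rfl) (fun h => G.ne_of_adj h rfl)⟩

/-- The set of directed edges `u → v` of `G`. -/
abbrev Edge : Type _ := {e : V × V // G.Adj e.1 e.2}

open Classical in
/-- The directed edge of `G` underlying a step of an undirected walk. -/
def arrow (d : G.skeleton.Dart) : G.Edge :=
  if h : G.Adj d.fst d.snd then ⟨(d.fst, d.snd), h⟩
  else ⟨(d.snd, d.fst), d.adj.resolve_left h⟩

/-- No two distinct edges `i → k` and `j → k` of the walk have the same head. -/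
def NoCollider {u v : V} (p : G.skeleton.Walk u v) : Prop :=
  ∀ i j k, i ≠ j → s(i, k) ∈ p.edges → s(j, k) ∈ p.edges → ¬ (G.Adj i k ∧ G.Adj j k)

/-- A trek from `i` to `j`: a simple path in `G` (whose edges may be traversed in either
direction) without a collider. -/
def Trek (i j : V) : Type _ := {p : G.skeleton.Walk i j // p.IsPath ∧ G.NoCollider p}

instance [Finite V] (i j : V) : Finite (G.Trek i j) := by
  classical
  have := Fintype.ofFinite V
  exact Finite.of_injective (β := G.skeleton.Path i j) (fun p => ⟨p.1, p.2.1⟩)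
    (fun _ _ h => Subtype.ext (congrArg (fun r : G.skeleton.Path i j => r.1) h))

instance [Finite V] (i j : V) : Fintype (G.Trek i j) := Fintype.ofFinite _

open Classical in
/-- The topmost vertex of a colliderless walk: go up against the arrows until the walk ends or
turns downwards. -/
def top {u : V} : {v : V} → G.skeleton.Walk u v → V
  | _, .nil => u
  | _, .cons (v := x) _ p => if G.Adj u x then u else top p

/-- The indeterminates of the parameter ring: `a_v` for the vertices (`Sum.inl v`) and `λ_{uv}`
for the directed edges (`Sum.inr ⟨(u, v), _⟩`). -/
abbrev Param : Type _ := V ⊕ G.Edge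

/-- `a_{top(P)} * ∏_{k → l ∈ P} λ_{kl}`. -/
def walkMonomial {u v : V} (p : G.skeleton.Walk u v) : MvPolynomial G.Param ℂ :=
  MvPolynomial.X (Sum.inl (G.top p)) *
    (p.darts.map fun d => MvPolynomial.X (Sum.inr (G.arrow d))).prod

/-- `∑_{P ∈ T(i,j)} a_{top(P)} * ∏_{k → l ∈ P} λ_{kl}`. -/
def trekSum [Finite V] (i j : V) : MvPolynomial G.Param ℂ :=
  ∑ P : G.Trek i j, G.walkMonomial P.1

/-! Reversal of treks, showing that the trek sum is symmetric in its two end points. -/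

theorem arrow_symm (d : G.skeleton.Dart) : G.arrow d.symm = G.arrow d := by
  unfold arrow
  rcases d.adj with h | h
  · have h' := G.asymm h
    simp [h, h']
  · have h' := G.asymm h
    simp [h, h']

variable {G}

theorem NoCollider.reverse {u v : V} {p : G.skeleton.Walk u v} (h : G.NoCollider p) :
    G.NoCollider p.reverse := by
  intro i j k hij h1 h2
  rw [SimpleGraph.Walk.edges_reverse, List.mem_reverse] at h1 h2
  exact h i j k hij h1 h2

theorem NoCollider.of_cons {u v w : V} {h : G.skeleton.Adj u v} {p : G.skeleton.Walk v w}
    (hp : G.NoCollider (.cons h p)) : G.NoCollider p := by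
  intro i j k hij h1 h2
  exact hp i j k hij (by simp [h1]) (by simp [h2])

theorem top_mem_support {u v : V} (p : G.skeleton.Walk u v) : G.top p ∈ p.support := by
  induction p with
  | nil => simp [top]
  | cons h p ih =>
    unfold top
    split_ifs
    · simp
    · simp [ih]

theorem exists_in_of_down {u v w : V} (h : G.skeleton.Adj u v) (p : G.skeleton.Walk v w)
    (hp : (SimpleGraph.Walk.cons h p).IsPath) (hc : G.NoCollider (.cons h p)) (huv : G.Adj u v) :
    ∀ x ∈ p.support, ∃ y, s(y, x) ∈ (SimpleGraph.Walk.cons h p).edges ∧ G.Adj y x := by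
  induction p generalizing u with
  | nil =>
    intro x hx
    simp only [SimpleGraph.Walk.support_nil, List.mem_singleton] at hx
    subst hx
    exact ⟨u, by simp, huv⟩
  | @cons a b c hab q ih =>
    intro x hx
    rw [SimpleGraph.Walk.support_cons, List.mem_cons] at hx
    rcases hx with rfl | hx
    · exact ⟨u, by simp, huv⟩
    · have hub : u ≠ b := by
        rintro rfl
        rw [SimpleGraph.Walk.cons_isPath_iff] at hp
        exact hp.2 (by simp)
      have hab' : G.Adj a b := by
        have hab2 : G.Adj a b ∨ G.Adj b a := hab
        rcases hab2 with h1 | h1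
        · exact h1
        · exact absurd ⟨huv, h1⟩ (hc u b a hub (by simp)
            (by simp [Sym2.eq_swap]))
      obtain ⟨y, hy, hyx⟩ := ih hab ((SimpleGraph.Walk.cons_isPath_iff _ _).1 hp).1
        hc.of_cons hab' x hx
      exact ⟨y, by rw [SimpleGraph.Walk.edges_cons]; exact List.mem_cons_of_mem _ hy, hyx⟩

/-- The top of a trek is its unique vertex that is not the head of an edge of the trek. -/
theorem eq_top_iff {u v : V} (p : G.skeleton.Walk u v) (hp : p.IsPath) (hc : G.NoCollider p)
    (x : V) : x = G.top p ↔ x ∈ p.support ∧ ∀ y, s(y, x) ∈ p.edges → ¬ G.Adj y x := by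
  induction p with
  | nil => simp [top]
  | @cons a b c hab q ih =>
    have hp' := (SimpleGraph.Walk.cons_isPath_iff _ _).1 hp
    unfold top
    split_ifs with h
    · constructor
      · rintro rfl
        refine ⟨by simp, fun y hy hyx => ?_⟩
        rw [SimpleGraph.Walk.edges_cons, List.mem_cons] at hy
        rcases hy with hy | hy
        · rw [Sym2.eq_iff] at hy
          rcases hy with ⟨h1, h2⟩ | ⟨h1, h2⟩
          · exact G.ne_of_adj h h2
          · subst h1
            exact G.asymm h hyx
        · exact hp'.2 (q.snd_mem_support_of_mem_edges hy)
      · rintro ⟨hx, hx'⟩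
        rw [SimpleGraph.Walk.support_cons, List.mem_cons] at hx
        rcases hx with rfl | hx
        · rfl
        · obtain ⟨y, hy, hyx⟩ := exists_in_of_down hab q hp hc h x hx
          exact absurd hyx (hx' y hy)
    · have hba : G.Adj b a := hab.resolve_left h
      rw [ih hp'.1 hc.of_cons]
      constructor
      · rintro ⟨hx, hx'⟩
        refine ⟨by simp [hx], fun y hy hyx => ?_⟩
        rw [SimpleGraph.Walk.edges_cons, List.mem_cons] at hy
        rcases hy with hy | hy
        · rw [Sym2.eq_iff] at hy
          rcases hy with ⟨h1, h2⟩ | ⟨h1, h2⟩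
          · subst h1 h2
            exact h hyx
          · subst h2
            exact hp'.2 hx
        · exact hx' y hy hyx
      · rintro ⟨hx, hx'⟩
        refine ⟨?_, fun y hy => hx' y (by simp [hy])⟩
        rw [SimpleGraph.Walk.support_cons, List.mem_cons] at hx
        rcases hx with rfl | hx
        · exact absurd hba (hx' b (by simp [Sym2.eq_swap]))
        · exact hx

theorem top_reverse {u v : V} (p : G.skeleton.Walk u v) (hp : p.IsPath) (hc : G.NoCollider p) :
    G.top p.reverse = G.top p := by
  have h := (eq_top_iff p.reverse hp.reverse hc.reverse (G.top p.reverse)).1 rfl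
  rw [eq_top_iff p hp hc]
  simpa using h

theorem walkMonomial_reverse {u v : V} (p : G.skeleton.Walk u v) (hp : p.IsPath)
    (hc : G.NoCollider p) : G.walkMonomial p.reverse = G.walkMonomial p := by
  unfold walkMonomial
  rw [top_reverse p hp hc, SimpleGraph.Walk.darts_reverse, List.map_reverse, List.prod_reverse,
    List.map_map]
  congr 3
  funext d
  simp [arrow_symm]

variable (G)

/-- Reversal of treks. -/
def trekReverse (i j : V) : G.Trek i j ≃ G.Trek j i where
  toFun P := ⟨P.1.reverse, P.2.1.reverse, P.2.2.reverse⟩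
  invFun P := ⟨P.1.reverse, P.2.1.reverse, P.2.2.reverse⟩
  left_inv P := Subtype.ext P.1.reverse_reverse
  right_inv P := Subtype.ext P.1.reverse_reverse

theorem trekSum_comm [Finite V] (i j : V) : G.trekSum i j = G.trekSum j i :=
  Fintype.sum_equiv (G.trekReverse i j) _ _
    fun P => (walkMonomial_reverse P.1 P.2.1 P.2.2).symm

/-- The trek rule homomorphism `φ_G : ℂ[σ_ij] → ℂ[a, λ]`. The indeterminates `σ_ij = σ_ji` are
indexed by unordered pairs of vertices. -/
def trekHom [Finite V] : MvPolynomial (Sym2 V) ℂ →ₐ[ℂ] MvPolynomial G.Param ℂ :=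
  MvPolynomial.aeval (Sym2.lift ⟨G.trekSum, G.trekSum_comm⟩)

/-- The ideal `I_G` of the Gaussian Bayesian network `G`. -/
def ideal [Finite V] : Ideal (MvPolynomial (Sym2 V) ℂ) := RingHom.ker G.trekHom

/-- The hidden variable ideal `I_{G,O} = I_G ∩ ℂ[σ_ij | i, j ∈ O]`, where the set `O` of observed
vertices is given by its inclusion `o` into `V`. -/
def hiddenIdeal [Finite V] {O : Type*} (o : O ↪ V) : Ideal (MvPolynomial (Sym2 O) ℂ) :=
  G.ideal.comap (MvPolynomial.rename (Sym2.map o))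

end DAG

section Schubert

variable {n : ℕ}

/-- A `0/1` matrix with at most one `1` in each row and each column. -/
def IsPartialPermutation (w : Matrix (Fin n) (Fin n) ℂ) : Prop :=
  (∀ i j, w i j = 0 ∨ w i j = 1) ∧
  (∀ i j j', w i j = 1 → w i j' = 1 → j = j') ∧
  (∀ i i' j, w i j = 1 → w i' j = 1 → i = i')

/-- `b` belongs to the Borel group of invertible upper triangular matrices. -/
def IsBorel (b : Matrix (Fin n) (Fin n) ℂ) : Prop :=
  IsUnit b ∧ b.BlockTriangular id

/-- The double orbit `Bᵀ w B`, as a set of points of the affine space with coordinates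
indexed by `[n] × [n']`. -/
def borelOrbit (w : Matrix (Fin n) (Fin n) ℂ) : Set (Fin n × Fin n → ℂ) :=
  {x | ∃ b c : Matrix (Fin n) (Fin n) ℂ, IsBorel b ∧ IsBorel c ∧ ∀ i j, x (i, j) = (b.transpose * w * c) i j}

/-- The matrix Schubert variety `X_w`: the Zariski closure of `Bᵀ w B`. -/
def matrixSchubertVariety (w : Matrix (Fin n) (Fin n) ℂ) : Set (Fin n × Fin n → ℂ) :=
  MvPolynomial.zeroLocus ℂ (MvPolynomial.vanishingIdeal ℂ (borelOrbit w))

/-- The vanishing ideal `I_w` of `X_w`. -/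
def schubertIdeal (w : Matrix (Fin n) (Fin n) ℂ) : Ideal (MvPolynomial (Fin n × Fin n) ℂ) :=
  MvPolynomial.vanishingIdeal ℂ (matrixSchubertVariety w)

/-- The positions `S(w)` of the ones of `w`. -/
abbrev Ones (w : Matrix (Fin n) (Fin n) ℂ) : Type := {s : Fin n × Fin n // w s.1 s.2 = 1}

/-- The observed vertices `[n] ∪ [n']`: `Sum.inl i` is `i` and `Sum.inr j` is `j'`. -/
abbrev Observed (n : ℕ) : Type := Fin n ⊕ Fin n

/-- The edges of `G(w)` on the vertex set `([n] ∪ [n']) ∪ S(w)`. -/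
inductive SchubertEdge (w : Matrix (Fin n) (Fin n) ℂ) :
    Observed n ⊕ Ones w → Observed n ⊕ Ones w → Prop
  | unprimed {k l : Fin n} : k < l → SchubertEdge w (.inl (.inl k)) (.inl (.inl l))
  | primed {k l : Fin n} : k < l → SchubertEdge w (.inl (.inr k)) (.inl (.inr l))
  | hiddenUnprimed {s : Ones w} {k : Fin n} :
      s.1.1 ≤ k → SchubertEdge w (.inr s) (.inl (.inl k))
  | hiddenPrimed {s : Ones w} {k : Fin n} :
      s.1.2 ≤ k → SchubertEdge w (.inr s) (.inl (.inr k))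

/-- A numbering of the vertices of `G(w)` that increases along all edges. -/
def schubertRank (w : Matrix (Fin n) (Fin n) ℂ) : Observed n ⊕ Ones w → ℕ
  | .inl (.inl k) => k + 1
  | .inl (.inr k) => k + 1
  | .inr _ => 0

theorem SchubertEdge.rank_lt {w : Matrix (Fin n) (Fin n) ℂ} {u v : Observed n ⊕ Ones w}
    (h : SchubertEdge w u v) : schubertRank w u < schubertRank w v := by
  cases h <;> simp_all [schubertRank]

/-- The directed acyclic graph `G(w)`. -/
def schubertDAG (w : Matrix (Fin n) (Fin n) ℂ) : DAG (Observed n ⊕ Ones w) where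
  Adj := SchubertEdge w
  acyclic v h := by
    have key : ∀ u, Relation.TransGen (SchubertEdge w) v u →
        schubertRank w v < schubertRank w u := by
      intro u hu
      induction hu with
      | single h => exact h.rank_lt
      | tail _ h ih => exact ih.trans h.rank_lt
    exact lt_irrefl _ (key v h)

/-- The inclusion `ℂ[σ_ij | i ∈ [n], j ∈ [n']] → ℂ[σ_ij | i, j ∈ [n] ∪ [n']]`. -/
def crossInclusion (n : ℕ) :
    MvPolynomial (Fin n × Fin n) ℂ →ₐ[ℂ] MvPolynomial (Sym2 (Observed n)) ℂ :=
  MvPolynomial.rename fun p => s(Sum.inl p.1, Sum.inr p.2)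

end Schubert

end

/-!
Both ideals are vanishing ideals. The left one vanishes on the matrices over `[n] ∪ [n']` whose
cross block `[n] × [n']` has the form `bᵀ w c` with `b`, `c` upper triangular; allowing `b` and `c`
to be singular does not change the closure of the orbit. The right one vanishes on the observed
blocks of the covariance matrices of `G(w)`. A trek from `u` to a vertex `v` that is not a
descendant of `u` starts by going up to a parent of `u`, so a covariance matrix is a symmetric
matrix `S` with `S u v = ∑ λ_{ku} S k v`, the sum over the parents `k` of `u`, for all such `u` and
`v`.

In `G(w)` these equations read `Q = Lᵀ Q + Mᵀ N`, where `Q` is the cross block, `L` is strictly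
upper triangular and the rows of `M` and `N`, indexed by `S(w)`, start at the positions of the ones
of `w`. Hence `Q = (M (1 - L)⁻¹)ᵀ N`, and this is of the form `bᵀ w c`. Conversely, write the cross
block of a symmetric matrix `z` as `Mᵀ N` with such `M` and `N`, and put `U = (M N)`. The cross
block of `A = z - Uᵀ U` vanishes, so the equations decouple into linear systems for the edge weights
in `[n]` and in `[n']`, which are solvable if all leading principal minors of the two diagonal
blocks of `A` are nonzero. This holds after replacing `z` by `z + t • 1` for all small `t ≠ 0`, so
`z` is a limit of observed covariances.
-/

section VanishingIdeal

open MvPolynomial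

variable {σ τ : Type*}

section CommSemiring

variable {R : Type*} [CommSemiring R]

/-- The map `R[τ] → R[σ][τ]` that moves the variables in the image of `ι : σ → τ` into the
coefficients. The ring `R[σ][τ]` keeps its superfluous variables `ι a`, which spares a splitting of
`τ` into the image of `ι` and its complement. -/
noncomputable def moveToCoefficients (ι : σ → τ) :
    MvPolynomial τ R →ₐ[R] MvPolynomial τ (MvPolynomial σ R) :=
  aeval (Function.extend ι (fun a => C (X a)) X)

variable {ι : σ → τ}

theorem eval₂Hom_rename_moveToCoefficients (hι : ι.Injective) (f : MvPolynomial τ R) :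
    eval₂Hom (rename ι : MvPolynomial σ R →ₐ[R] MvPolynomial τ R).toRingHom X
      (moveToCoefficients ι f) = f := by
  suffices (eval₂Hom (rename ι : MvPolynomial σ R →ₐ[R] MvPolynomial τ R).toRingHom X).comp
      (moveToCoefficients ι).toRingHom = RingHom.id _ from RingHom.congr_fun this f
  refine ringHom_ext (fun r => ?_) fun b => ?_
  · simp [moveToCoefficients, IsScalarTower.algebraMap_apply R (MvPolynomial σ R)]
  · by_cases hb : ∃ a, ι a = b
    · obtain ⟨a, rfl⟩ := hb
      simp [moveToCoefficients, hι.extend_apply]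
    · simp [moveToCoefficients, Function.extend_apply' _ _ _ hb]

theorem eval_map_eval_moveToCoefficients (hι : ι.Injective) (x : σ → R) (y : τ → R)
    (f : MvPolynomial τ R) :
    eval y (map (eval x) (moveToCoefficients ι f)) = eval (Function.extend ι x y) f := by
  suffices ((eval y).comp (map (eval x))).comp (moveToCoefficients ι).toRingHom =
      eval (Function.extend ι x y) from RingHom.congr_fun this f
  refine ringHom_ext (fun r => ?_) fun b => ?_
  · simp [moveToCoefficients, IsScalarTower.algebraMap_apply R (MvPolynomial σ R)]
  · by_cases hb : ∃ a, ι a = b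
    · obtain ⟨a, rfl⟩ := hb
      simp [moveToCoefficients, hι.extend_apply]
    · simp [moveToCoefficients, Function.extend_apply' _ _ _ hb]

end CommSemiring

variable {K : Type*} [Field K]

theorem vanishingIdeal_eq_of_subset_of_subset_closure [TopologicalSpace K]
    [IsTopologicalSemiring K] [T1Space K] {S T : Set (σ → K)} (hST : S ⊆ T)
    (hTS : T ⊆ closure S) : vanishingIdeal K S = vanishingIdeal K T := by
  refine le_antisymm (fun f hf x hx => ?_) (vanishingIdeal_anti_mono hST)
  have isClosed_zeros : IsClosed {x : σ → K | aeval x f = 0} :=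
    isClosed_singleton.preimage f.continuous_eval
  exact closure_minimal (fun y hy => hf y hy) isClosed_zeros (hTS hx)

theorem mem_map_C_vanishingIdeal [Infinite K] {S : Set (σ → K)}
    {F : MvPolynomial τ (MvPolynomial σ K)}
    (hF : ∀ x ∈ S, ∀ y, eval y (map (eval x) F) = 0) :
    F ∈ (vanishingIdeal K S).map (C : MvPolynomial σ K →+* MvPolynomial τ (MvPolynomial σ K)) := by
  refine mem_map_C_iff.2 fun m x hx => ?_
  have map_eq_zero : map (eval x) F = 0 := MvPolynomial.funext fun y => by rw [hF x hx, map_zero]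
  rw [aeval_eq_eval, ← coeff_map, map_eq_zero, coeff_zero]

theorem map_rename_vanishingIdeal [Infinite K] {ι : σ → τ} (hι : ι.Injective)
    (S : Set (σ → K)) :
    (vanishingIdeal K S).map (rename ι : MvPolynomial σ K →ₐ[K] MvPolynomial τ K) =
      vanishingIdeal K {z | z ∘ ι ∈ S} := by
  refine le_antisymm (Ideal.map_le_iff_le_comap.2 fun f hf z hz => ?_) fun f hf => ?_
  · rw [aeval_rename]
    exact hf _ hz
  · have mem_map_C : moveToCoefficients ι f ∈ (vanishingIdeal K S).map C :=
      mem_map_C_vanishingIdeal fun x hx y => by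
        rw [eval_map_eval_moveToCoefficients hι]
        exact hf _ (by rwa [Set.mem_ofPred_eq, Function.extend_comp hι])
    have mem_map := Ideal.mem_map_of_mem
      (eval₂Hom (rename ι : MvPolynomial σ K →ₐ[K] MvPolynomial τ K).toRingHom X) mem_map_C
    rwa [eval₂Hom_rename_moveToCoefficients hι, Ideal.map_map, eval₂Hom_comp_C] at mem_map

end VanishingIdeal

section Matrix

open Matrix Filter Topology

theorem exists_blockTriangular_submatrix_eq {ι m R : Type*} [LinearOrder m] [Zero R] {p : ι → m}
    (hp : p.Injective) {M : Matrix ι m R} (hM : ∀ s j, j < p s → M s j = 0) :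
    ∃ b : Matrix m m R, b.BlockTriangular id ∧ b.submatrix p id = M := by
  refine ⟨.of fun i j => Function.extend p (fun s => M s j) 0 i, fun i j hji => ?_, ?_⟩
  · by_cases hi : ∃ s, p s = i
    · obtain ⟨s, rfl⟩ := hi
      rw [of_apply, hp.extend_apply]
      exact hM s j hji
    · rw [of_apply, Function.extend_apply' _ _ _ hi, Pi.zero_apply]
  · ext s j
    rw [submatrix_apply, of_apply, hp.extend_apply, id_eq]

variable {m K : Type*} [Fintype m] [Field K]

theorem eventually_det_add_smul_one_ne_zero [DecidableEq m] [TopologicalSpace K] [T1Space K]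
    (A : Matrix m m K) : ∀ᶠ t in 𝓝[≠] (0 : K), (A + t • (1 : Matrix m m K)).det ≠ 0 := by
  have finite_roots : {t | (-A).charpoly.IsRoot t}.Finite :=
    Polynomial.finite_setOfPred_isRoot (charpoly_monic (-A)).ne_zero
  have isClosed_roots : IsClosed ({t | (-A).charpoly.IsRoot t} \ {0}) :=
    (finite_roots.subset Set.sdiff_subset).isClosed
  filter_upwards [nhdsWithin_le_nhds (isClosed_roots.isOpen_compl.mem_nhds (by simp)),
    self_mem_nhdsWithin] with t ht ht0 hdet
  refine ht ⟨?_, ht0⟩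
  rw [Set.mem_ofPred_eq, Polynomial.IsRoot, eval_charpoly, ← hdet, sub_neg_eq_add, add_comm,
    smul_one_eq_diagonal, scalar_apply]

theorem exists_blockTriangular_one_sub_mul_eq_one {R : Type*} [CommRing R] [LinearOrder m]
    {L : Matrix m m R} (hL : ∀ k j, ¬ k < j → L k j = 0) :
    ∃ T : Matrix m m R, T.BlockTriangular id ∧ (1 - L) * T = 1 := by
  have upper : (1 - L).IsUpperTriangular :=
    blockTriangular_one.sub fun k j hjk => hL k j hjk.not_gt
  have isUnit_det : IsUnit (1 - L).det := by
    rw [det_of_isUpperTriangular upper]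
    simp [hL]
  let _ := invertibleOfIsUnitDet _ isUnit_det
  exact ⟨(1 - L)⁻¹, blockTriangular_inv_of_blockTriangular upper, mul_nonsing_inv _ isUnit_det⟩

theorem exists_transpose_mul_apply_eq {r : m → m → Prop} [∀ j, DecidablePred (r · j)]
    [DecidableEq m] (A : Matrix m m K)
    (hA : ∀ j, (A.submatrix (Subtype.val : {k // r k j} → m) Subtype.val).det ≠ 0) :
    ∃ L : Matrix m m K, (∀ k j, ¬ r k j → L k j = 0) ∧ ∀ i j, r i j → (Lᵀ * A) j i = A j i := by
  -- Column `j` of `L` solves the linear system whose matrix is the one of `hA j`.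
  choose x hx using fun j => vecMul_surjective_iff_isUnit.2
    ((isUnit_iff_isUnit_det _).2 (hA j).isUnit) fun i : {k // r k j} => A j i
  let L : Matrix m m K := .of fun k j => if h : r k j then x j ⟨k, h⟩ else 0
  have L_eq_zero : ∀ k j, ¬ r k j → L k j = 0 := fun k j h => dif_neg h
  have L_eq : ∀ j (k : {k // r k j}), L k j = x j k := fun j k => dif_pos k.2
  refine ⟨L, L_eq_zero, fun i j hij => ?_⟩
  have solution : ∑ k : {k // r k j}, x j k * A k i = A j i := congrFun (hx j) ⟨i, hij⟩
  rw [← solution, mul_apply]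
  refine (Fintype.sum_of_injective _ Subtype.val_injective _ _ (fun k hk => ?_) fun k => ?_).symm
  · rw [transpose_apply, L_eq_zero k j fun hkj => hk ⟨⟨k, hkj⟩, rfl⟩, zero_mul]
  · rw [transpose_apply, L_eq]

end Matrix

namespace DAG

open Matrix MvPolynomial Relation SimpleGraph

variable {V : Type*} {G : DAG V}

section Treks

theorem skeleton_adj_of_adj {u v : V} (h : G.Adj v u) : G.skeleton.Adj u v := .inr h

theorem reflTransGen_of_noCollider_cons {u v w : V} (h : G.skeleton.Adj u v)
    (p : G.skeleton.Walk v w) (hp : (Walk.cons h p).IsPath) (hc : G.NoCollider (.cons h p))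
    (huv : G.Adj u v) : ReflTransGen G.Adj v w := by
  induction p generalizing u with
  | nil => exact .refl
  | @cons v x w hvx q ih =>
    have hux : u ≠ x := by
      rintro rfl
      exact ((Walk.cons_isPath_iff _ _).1 hp).2 (by simp)
    have adj_vx : G.Adj v x := hvx.resolve_right fun hxv =>
      hc u x v hux (by simp) (by simp [Sym2.eq_swap]) ⟨huv, hxv⟩
    exact .head adj_vx (ih hvx hp.of_cons hc.of_cons adj_vx)

theorem reflTransGen_of_mem_support {u v x : V} {p : G.skeleton.Walk u v} (hp : p.IsPath)
    (hc : G.NoCollider p) (hx : x ∈ p.support) :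
    ReflTransGen G.Adj x u ∨ ReflTransGen G.Adj x v := by
  induction p with
  | nil => exact .inl (by simp_all [ReflTransGen.refl])
  | @cons u y v huy q ih =>
    rw [Walk.support_cons, List.mem_cons] at hx
    obtain rfl | hx := hx
    · exact .inl .refl
    obtain hxy | hxv := ih hp.of_cons hc.of_cons hx
    · obtain adj_uy | adj_yu := huy
      · exact .inr (hxy.trans (reflTransGen_of_noCollider_cons _ q hp hc adj_uy))
      · exact .inl (hxy.tail adj_yu)
    · exact .inr hxv

theorem NoCollider.cons_of_notMem {u v w : V} {p : G.skeleton.Walk v w} (hc : G.NoCollider p)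
    (hvu : G.Adj v u) (hu : u ∉ p.support) : G.NoCollider (.cons (skeleton_adj_of_adj hvu) p) := by
  have head_eq : ∀ x z, G.Adj x z → s(x, z) = s(u, v) → x = v ∧ z = u := by
    rintro x z hxz h
    obtain ⟨rfl, rfl⟩ | h := Sym2.eq_iff.1 h
    exacts [absurd hvu (G.asymm hxz), h]
  intro x y z hxy hx hy ⟨hxz, hyz⟩
  rw [Walk.edges_cons, List.mem_cons] at hx hy
  rcases hx with hx | hx <;> rcases hy with hy | hy
  · exact hxy (Sym2.congr_left.1 (hx.trans hy.symm))
  · exact hu ((head_eq x z hxz hx).2 ▸ p.snd_mem_support_of_mem_edges hy)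
  · exact hu ((head_eq y z hyz hy).2 ▸ p.snd_mem_support_of_mem_edges hx)
  · exact hc x y z hxy hx hy ⟨hxz, hyz⟩

/-- The trek from `u` to `v` that starts by going up to the parent `k` of `u`, for `v` not a
descendant of `u`. -/
def Trek.consParent {u v k : V} (huv : ¬ ReflTransGen G.Adj u v) (hku : G.Adj k u)
    (P : G.Trek k v) : G.Trek u v :=
  have hu : u ∉ P.1.support := fun hu =>
    (reflTransGen_of_mem_support P.2.1 P.2.2 hu).elim (fun huk => G.acyclic u (.tail' huk hku)) huv
  ⟨.cons (skeleton_adj_of_adj hku) P.1, P.2.1.cons hu, P.2.2.cons_of_notMem hku hu⟩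

theorem bijective_consParent {u v : V} (huv : ¬ ReflTransGen G.Adj u v) :
    Function.Bijective fun P : Σ k : {k // G.Adj k u}, G.Trek k v =>
      P.2.consParent huv P.1.2 := by
  constructor
  · rintro ⟨⟨k, hk⟩, P⟩ ⟨⟨l, hl⟩, Q⟩ h
    have h' := congrArg Subtype.val h
    simp only [Trek.consParent, Walk.cons.injEq] at h'
    obtain ⟨rfl, h'⟩ := h'
    rw [show P = Q from Subtype.ext (eq_of_heq h')]
  · rintro ⟨p, hp, hc⟩
    cases p with
    | nil => exact absurd .refl huv
    | @cons _ k _ huk q =>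
      have hku : G.Adj k u := huk.resolve_left fun adj_uk =>
        huv (.head adj_uk (reflTransGen_of_noCollider_cons huk q hp hc adj_uk))
      exact ⟨⟨⟨k, hku⟩, q, hp.of_cons, hc.of_cons⟩, rfl⟩

theorem walkMonomial_cons_parent {u v k : V} (hku : G.Adj k u) (p : G.skeleton.Walk k v) :
    G.walkMonomial (.cons (skeleton_adj_of_adj hku) p) =
      X (.inr ⟨(k, u), hku⟩) * G.walkMonomial p := by
  simp only [walkMonomial, top, G.asymm hku, if_false, Walk.darts_cons, List.map_cons,
    List.prod_cons, arrow, dif_neg, not_false_eq_true]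
  ring

variable [Finite V]

theorem trekSum_self (v : V) : G.trekSum v v = X (.inl v) := by
  let nilTrek : G.Trek v v := ⟨.nil, .nil, fun _ _ _ _ h => by simp at h⟩
  have eq_nilTrek : ∀ P : G.Trek v v, P = nilTrek := fun P =>
    Subtype.ext (Walk.eq_nil_iff_nil.2 (Walk.isPath_iff_nil.1 P.2.1))
  rw [trekSum, Fintype.sum_eq_single nilTrek fun P hP => absurd (eq_nilTrek P) hP]
  simp [nilTrek, walkMonomial, top]

theorem trekSum_eq_sum_parents {u v : V} [Fintype {k // G.Adj k u}]
    (huv : ¬ ReflTransGen G.Adj u v) :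
    G.trekSum u v = ∑ k : {k // G.Adj k u}, X (.inr ⟨(k.1, u), k.2⟩) * G.trekSum k v := by
  rw [trekSum, ← (bijective_consParent huv).sum_comp fun P => G.walkMonomial P.1,
    Fintype.sum_sigma]
  refine Finset.sum_congr rfl fun k _ => ?_
  rw [trekSum, Finset.mul_sum]
  exact Finset.sum_congr rfl fun P _ => walkMonomial_cons_parent k.2 P.1

end Treks

section Covariance

variable (G)

/-- The covariance matrix at a point `θ` of the parameter space, according to the trek rule. -/
noncomputable def covariance [Finite V] (θ : G.Param → ℂ) : Matrix V V ℂ :=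
  .of fun u v => aeval θ (G.trekSum u v)

open Classical in
/-- The edge parameters of `θ` as a matrix, with zeros at the pairs that are not edges. -/
noncomputable def edgeWeights (θ : G.Param → ℂ) : Matrix V V ℂ :=
  .of fun u v => if h : G.Adj u v then θ (.inr ⟨(u, v), h⟩) else 0

/-- A symmetric matrix `S` satisfies the structural equations of `G` with the edge weights `Λ` if
each row `u` is the combination, with weights `Λ · u`, of the rows of the parents of `u`, up to the
entries at the descendants of `u` (which include `u`). -/
structure IsStructural {R : Type*} [NonUnitalNonAssocSemiring R] [Fintype V]
    (Λ S : Matrix V V R) : Prop where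
  weight_eq_zero : ∀ ⦃u v⦄, ¬ G.Adj u v → Λ u v = 0
  isSymm : S.IsSymm
  apply_eq : ∀ ⦃u v⦄, ¬ ReflTransGen G.Adj u v → S u v = (Λᵀ * S) u v

variable {G}

theorem wellFounded_adj [Finite V] : WellFounded G.Adj :=
  have : IsTrans V (TransGen G.Adj) := inferInstance
  have : Std.Irrefl (TransGen G.Adj) := ⟨G.acyclic⟩
  (Finite.wellFounded_of_trans_of_irrefl (TransGen G.Adj)).mono fun _ _ => .single

theorem covariance_self [Finite V] (θ : G.Param → ℂ) (v : V) :
    G.covariance θ v v = θ (.inl v) := by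
  simp [covariance, trekSum_self]

variable [Fintype V]

theorem isStructural_covariance (θ : G.Param → ℂ) :
    G.IsStructural (G.edgeWeights θ) (G.covariance θ) where
  weight_eq_zero _ _ h := dif_neg h
  isSymm := .ext fun u v => congrArg (aeval θ) (G.trekSum_comm v u)
  apply_eq u v huv := by
    classical
    rw [covariance, of_apply, trekSum_eq_sum_parents huv, map_sum]
    refine Fintype.sum_of_injective _ Subtype.val_injective _ _ (fun k hk => ?_) fun k => ?_
    · have hku : ¬ G.Adj k u := fun hku => hk ⟨⟨k, hku⟩, rfl⟩
      simp [edgeWeights, hku]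
    · simp [edgeWeights, k.2]

theorem IsStructural.apply_eq_zero {R : Type*} [NonUnitalNonAssocSemiring R] {Λ S : Matrix V V R}
    (h : G.IsStructural Λ S) {u v : V} (hu : ∀ k, ¬ G.Adj k u)
    (huv : ¬ ReflTransGen G.Adj u v) : S u v = 0 := by
  rw [h.apply_eq huv, mul_apply]
  refine Finset.sum_eq_zero fun k _ => ?_
  rw [transpose_apply, h.weight_eq_zero (hu k), zero_mul]

theorem IsStructural.ext {R : Type*} [NonUnitalNonAssocSemiring R] {Λ S T : Matrix V V R}
    (hS : G.IsStructural Λ S) (hT : G.IsStructural Λ T) (h : ∀ v, S v v = T v v) : S = T := by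
  ext u v
  induction u, v using Sym2.GameAdd.recursion G.wellFounded_adj with | IH u v ih
  have eq_of_not_descendant : ∀ {u v}, (∀ k, G.Adj k u → S k v = T k v) →
      ¬ ReflTransGen G.Adj u v → S u v = T u v := by
    intro u v ih_parent huv
    rw [hS.apply_eq huv, hT.apply_eq huv, mul_apply, mul_apply]
    refine Finset.sum_congr rfl fun k _ => ?_
    by_cases hku : G.Adj k u
    · rw [ih_parent k hku]
    · rw [transpose_apply, hS.weight_eq_zero hku, zero_mul, zero_mul]
  by_cases huv : ReflTransGen G.Adj u v
  · obtain rfl | huv := reflTransGen_iff_eq_or_transGen.1 huv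
    · exact h _
    · rw [← hS.isSymm.apply, ← hT.isSymm.apply]
      exact eq_of_not_descendant (fun k hkv => ih k u (.fst_snd hkv))
        fun hvu => G.acyclic u (.trans_left huv hvu)
  · exact eq_of_not_descendant (fun k hku => ih k v (.fst hku)) huv

/-- The summand `Uᵀ * U` of the covariance matrix of the vertices `O` comes from the uncorrelated
sources `H`, so that `L` only has to solve the structural equations of the other summand `A`. -/
theorem isStructural_fromBlocks {O H R : Type*} [Fintype O] [Fintype H] [DecidableEq H]
    [CommRing R] {G : DAG (O ⊕ H)} [IsTrans (O ⊕ H) G.Adj] {L A : Matrix O O R} {U : Matrix H O R}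
    (hL : ∀ x y, ¬ G.Adj (.inl x) (.inl y) → L x y = 0)
    (hU : ∀ s x, ¬ G.Adj (.inr s) (.inl x) → U s x = 0) (hA : A.IsSymm)
    (hLA : ∀ x y, ¬ ReflTransGen G.Adj (.inl x) (.inl y) → A x y = (Lᵀ * A) x y) :
    G.IsStructural (fromBlocks L 0 (U - U * L) 0) (fromBlocks (A + Uᵀ * U) Uᵀ U 1) where
  weight_eq_zero := by
    have mul_eq_zero : ∀ s x, ¬ G.Adj (.inr s) (.inl x) → (U * L) s x = 0 := by
      refine fun s x hsx => Finset.sum_eq_zero fun y _ => ?_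
      by_cases hsy : G.Adj (.inr s) (.inl y)
      · exact mul_eq_zero_of_right _ (hL y x fun hyx => hsx (_root_.trans hsy hyx))
      · exact mul_eq_zero_of_left (hU s y hsy) _
    rintro (x | s) (y | t) h
    · exact hL x y h
    · rfl
    · rw [fromBlocks_apply₂₁, Matrix.sub_apply, hU s y h, mul_eq_zero s y h, sub_zero]
    · rfl
  isSymm := (hA.add (transpose_mul Uᵀ U)).fromBlocks (transpose_transpose U) isSymm_one
  apply_eq := by
    let Λ : Matrix (O ⊕ H) (O ⊕ H) R := fromBlocks L 0 (U - U * L) 0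
    have mul_eq : Λᵀ * fromBlocks (A + Uᵀ * U) Uᵀ U 1 = fromBlocks (Lᵀ * A + Uᵀ * U) Uᵀ 0 0 := by
      simp only [Λ, fromBlocks_transpose, fromBlocks_multiply, transpose_zero, Matrix.zero_mul,
        add_zero, Matrix.mul_one, transpose_sub, transpose_mul, Matrix.mul_add, Matrix.sub_mul,
        Matrix.mul_assoc, add_sub_cancel, add_add_sub_cancel]
    rw [mul_eq]
    rintro (x | s) (y | t) h
    · rw [fromBlocks_apply₁₁, fromBlocks_apply₁₁, Matrix.add_apply, Matrix.add_apply, hLA x y h]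
    · rfl
    · exact hU s y fun hsy => h (.single hsy)
    · exact one_apply_ne fun hst => h (hst ▸ .refl)

theorem IsStructural.exists_covariance_eq {Λ S : Matrix V V ℂ} (h : G.IsStructural Λ S) :
    ∃ θ, G.covariance θ = S := by
  let θ : G.Param → ℂ := Sum.elim (fun v => S v v) fun e => Λ e.1.1 e.1.2
  have edgeWeights_eq : G.edgeWeights θ = Λ := by
    ext u v
    by_cases huv : G.Adj u v
    · simp [edgeWeights, huv, θ]
    · simp [edgeWeights, huv, h.weight_eq_zero huv]
  exact ⟨θ, (edgeWeights_eq ▸ isStructural_covariance θ).ext h fun v => covariance_self θ v⟩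

end Covariance

variable (G) in
/-- The points of the affine space of symmetric matrices on `O` that are the observed part of a
covariance matrix of `G`. -/
def observedCovariances [Finite V] {O : Type*} (o : O ↪ V) : Set (Sym2 O → ℂ) :=
  {z | ∃ θ, ∀ x y, z s(x, y) = G.covariance θ (o x) (o y)}

theorem hiddenIdeal_eq_vanishingIdeal [Finite V] {O : Type*} (o : O ↪ V) :
    G.hiddenIdeal o = vanishingIdeal ℂ (G.observedCovariances o) := by
  have aeval_trekHom : ∀ (θ : G.Param → ℂ) (z : Sym2 O → ℂ),
      (∀ x y, z s(x, y) = G.covariance θ (o x) (o y)) → ∀ f,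
      aeval θ (G.trekHom (rename (Sym2.map o) f)) = aeval z f := by
    intro θ z hz f
    suffices ((aeval θ).comp G.trekHom).comp (rename (Sym2.map o)) = aeval z from
      DFunLike.congr_fun this f
    ext e
    induction e with | _ x y => simp [trekHom, hz, covariance]
  ext f
  constructor
  · rintro hf z ⟨θ, hθ⟩
    rw [← aeval_trekHom θ z hθ, show G.trekHom _ = 0 from hf, map_zero]
  · refine fun hf => MvPolynomial.funext fun θ => ?_
    let z : Sym2 O → ℂ := Sym2.lift ⟨fun x y => G.covariance θ (o x) (o y), fun x y =>
      congrArg (aeval θ) (G.trekSum_comm (o x) (o y))⟩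
    rw [map_zero]
    exact (aeval_trekHom θ z (fun _ _ => rfl) f).trans (hf z ⟨θ, fun _ _ => rfl⟩)

end DAG

section Orbit

open Filter Matrix MvPolynomial Topology

variable {n : ℕ} {w : Matrix (Fin n) (Fin n) ℂ}

/-- The analogue of `borelOrbit w` for all upper triangular matrices instead of only the invertible
ones. It lies between `borelOrbit w` and its closure. -/
def triangularOrbit (w : Matrix (Fin n) (Fin n) ℂ) : Set (Fin n × Fin n → ℂ) :=
  {x | ∃ b c : Matrix (Fin n) (Fin n) ℂ, b.BlockTriangular id ∧ c.BlockTriangular id ∧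
    ∀ i j, x (i, j) = (bᵀ * w * c) i j}

theorem borelOrbit_subset_triangularOrbit : borelOrbit w ⊆ triangularOrbit w :=
  fun _ ⟨b, c, hb, hc, h⟩ => ⟨b, c, hb.2, hc.2, h⟩

theorem eventually_isBorel_add_smul_one {b : Matrix (Fin n) (Fin n) ℂ}
    (hb : b.BlockTriangular id) : ∀ᶠ t in 𝓝[≠] (0 : ℂ), IsBorel (b + t • 1) := by
  filter_upwards [eventually_det_add_smul_one_ne_zero b] with t ht
  exact ⟨(isUnit_iff_isUnit_det _).2 ht.isUnit, hb.add <| by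
    rw [smul_one_eq_diagonal]
    exact blockTriangular_diagonal _⟩

theorem triangularOrbit_subset_closure_borelOrbit :
    triangularOrbit w ⊆ closure (borelOrbit w) := by
  rintro x ⟨b, c, hb, hc, hx⟩
  let Y (t : ℂ) : Matrix (Fin n) (Fin n) ℂ := (b + t • 1)ᵀ * w * (c + t • 1)
  let y (t : ℂ) (p : Fin n × Fin n) : ℂ := Y t p.1 p.2
  have y_zero : y 0 = x := funext fun p => by simp [y, Y, hx p.1 p.2]
  have continuous_y : Continuous y := by fun_prop
  refine mem_closure_of_tendsto (y_zero ▸ (continuous_y.tendsto 0).mono_left nhdsWithin_le_nhds)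
    (b := 𝓝[≠] 0) ?_
  filter_upwards [eventually_isBorel_add_smul_one hb, eventually_isBorel_add_smul_one hc]
    with t htb htc
  exact ⟨_, _, htb, htc, fun _ _ => rfl⟩

theorem schubertIdeal_eq_vanishingIdeal_triangularOrbit :
    schubertIdeal w = vanishingIdeal ℂ (triangularOrbit w) := by
  have eq_borelOrbit : schubertIdeal w = vanishingIdeal ℂ (borelOrbit w) :=
    zeroLocus_vanishingIdeal_galoisConnection.u_l_u_eq_u _
  rw [eq_borelOrbit]
  exact vanishingIdeal_eq_of_subset_of_subset_closure borelOrbit_subset_triangularOrbit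
    triangularOrbit_subset_closure_borelOrbit

theorem map_schubertIdeal_eq_vanishingIdeal :
    (schubertIdeal w).map (crossInclusion n) = vanishingIdeal ℂ
      {z : Sym2 (Observed n) → ℂ | (fun p => z s(.inl p.1, .inr p.2)) ∈ triangularOrbit w} := by
  rw [schubertIdeal_eq_vanishingIdeal_triangularOrbit]
  refine map_rename_vanishingIdeal (fun p q h => ?_) _
  simpa [Prod.ext_iff] using h

theorem transpose_mul_mul_eq (hw : IsPartialPermutation w) (b c : Matrix (Fin n) (Fin n) ℂ) :
    bᵀ * w * c = (b.submatrix (fun s : Ones w => s.1.1) id)ᵀ *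
      c.submatrix (fun s : Ones w => s.1.2) id := by
  ext i j
  simp only [mul_apply, transpose_apply, Finset.sum_mul, submatrix_apply, id_eq]
  rw [Finset.sum_comm, ← Fintype.sum_prod_type']
  refine (Fintype.sum_of_injective _ Subtype.val_injective _ _ (fun p hp => ?_) fun s => ?_).symm
  · have hp1 : w p.1 p.2 ≠ 1 := fun hp1 => hp ⟨⟨p, hp1⟩, rfl⟩
    rw [(hw.1 p.1 p.2).resolve_right hp1, mul_zero, zero_mul]
  · rw [s.2, mul_one]

theorem row_injective (hw : IsPartialPermutation w) :
    Function.Injective fun s : Ones w => s.1.1 := by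
  rintro ⟨⟨i, j⟩, hj⟩ ⟨⟨_, j'⟩, hj'⟩ rfl
  obtain rfl := hw.2.1 i j j' hj hj'
  rfl

theorem col_injective (hw : IsPartialPermutation w) :
    Function.Injective fun s : Ones w => s.1.2 := by
  rintro ⟨⟨i, j⟩, hi⟩ ⟨⟨i', _⟩, hi'⟩ rfl
  obtain rfl := hw.2.2 i i' j hi hi'
  rfl

theorem mem_triangularOrbit_iff (hw : IsPartialPermutation w) {x : Fin n × Fin n → ℂ} :
    x ∈ triangularOrbit w ↔ ∃ M N : Matrix (Ones w) (Fin n) ℂ, (∀ s j, j < s.1.1 → M s j = 0) ∧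
      (∀ s j, j < s.1.2 → N s j = 0) ∧ ∀ i j, x (i, j) = (Mᵀ * N) i j := by
  constructor
  · rintro ⟨b, c, hb, hc, hx⟩
    exact ⟨_, _, fun s j h => hb h, fun s j h => hc h, transpose_mul_mul_eq hw b c ▸ hx⟩
  · rintro ⟨M, N, hM, hN, hx⟩
    obtain ⟨b, hb, rfl⟩ := exists_blockTriangular_submatrix_eq (row_injective hw) hM
    obtain ⟨c, hc, rfl⟩ := exists_blockTriangular_submatrix_eq (col_injective hw) hN
    exact ⟨b, c, hb, hc, transpose_mul_mul_eq hw b c ▸ hx⟩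

end Orbit

section SchubertDAG

open DAG Filter Function Matrix Relation Topology

variable {n : ℕ} {w : Matrix (Fin n) (Fin n) ℂ}

instance : IsTrans (Observed n ⊕ Ones w) (schubertDAG w).Adj where
  trans _ _ _ huv hvx := by
    cases huv <;> cases hvx
    exacts [.unprimed (by order), .primed (by order), .hiddenUnprimed (by order),
      .hiddenPrimed (by order)]

theorem reflTransGen_schubertDAG_iff {u v : Observed n ⊕ Ones w} :
    ReflTransGen (schubertDAG w).Adj u v ↔ v = u ∨ (schubertDAG w).Adj u v := by
  rw [reflTransGen_iff_eq_or_transGen, transGen_eq_self]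

theorem not_schubertDAG_adj_inr (u : Observed n ⊕ Ones w) (s : Ones w) :
    ¬ (schubertDAG w).Adj u (.inr s) := nofun

theorem schubertDAG_adj_inl_inl {x y : Observed n} :
    (schubertDAG w).Adj (.inl x) (.inl y) ↔ x < y := by
  constructor
  · rintro (h | h)
    exacts [.inl h, .inr h]
  · rintro (h | h)
    exacts [.unprimed h, .primed h]

theorem schubertDAG_adj_inr_inl_inl {s : Ones w} {k : Fin n} :
    (schubertDAG w).Adj (.inr s) (.inl (.inl k)) ↔ s.1.1 ≤ k :=
  ⟨fun (.hiddenUnprimed h) => h, .hiddenUnprimed⟩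

theorem schubertDAG_adj_inr_inl_inr {s : Ones w} {k : Fin n} :
    (schubertDAG w).Adj (.inr s) (.inl (.inr k)) ↔ s.1.2 ≤ k :=
  ⟨fun (.hiddenPrimed h) => h, .hiddenPrimed⟩

theorem cross_eq_of_isStructural {Λ S : Matrix (Observed n ⊕ Ones w) (Observed n ⊕ Ones w) ℂ}
    (h : (schubertDAG w).IsStructural Λ S) :
    S.submatrix (.inl ∘ .inl) (.inl ∘ .inr) =
      (Λ.submatrix (.inl ∘ .inl) (.inl ∘ .inl))ᵀ * S.submatrix (.inl ∘ .inl) (.inl ∘ .inr) +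
        (Λ.submatrix .inr (.inl ∘ .inl))ᵀ * S.submatrix .inr (.inl ∘ .inr) := by
  ext i j
  have not_descendant :
      ¬ ReflTransGen (schubertDAG w).Adj (.inl (.inl i)) (.inl (.inr j)) := by
    simp [reflTransGen_schubertDAG_iff, schubertDAG_adj_inl_inl]
  have not_parent : ∀ k, Λ (.inl (.inr k)) (.inl (.inl i)) = 0 := fun k =>
    h.weight_eq_zero (by simp [schubertDAG_adj_inl_inl])
  refine (h.apply_eq not_descendant).trans ?_
  rw [mul_apply, Fintype.sum_sum_type, Fintype.sum_sum_type]
  simp only [transpose_apply, not_parent, zero_mul, Finset.sum_const_zero, add_zero]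
  rfl

theorem mem_triangularOrbit_of_isStructural (hw : IsPartialPermutation w)
    {Λ S : Matrix (Observed n ⊕ Ones w) (Observed n ⊕ Ones w) ℂ}
    (h : (schubertDAG w).IsStructural Λ S) :
    (fun p => S (.inl (.inl p.1)) (.inl (.inr p.2))) ∈ triangularOrbit w := by
  let L := Λ.submatrix (.inl ∘ .inl : Fin n → _) (.inl ∘ .inl : Fin n → _)
  let M := Λ.submatrix .inr (.inl ∘ .inl : Fin n → _)
  let N := S.submatrix .inr (.inl ∘ .inr : Fin n → _)
  let Q := S.submatrix (.inl ∘ .inl : Fin n → _) (.inl ∘ .inr : Fin n → _)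
  have L_eq_zero : ∀ k j, ¬ k < j → L k j = 0 := fun k j hkj => h.weight_eq_zero <| by
    rwa [Function.comp_apply, Function.comp_apply, schubertDAG_adj_inl_inl, Sum.inl_lt_inl_iff]
  have M_eq_zero : ∀ s j, j < s.1.1 → M s j = 0 := fun s j hj => h.weight_eq_zero <| by
    rwa [Function.comp_apply, schubertDAG_adj_inr_inl_inl, not_le]
  have N_eq_zero : ∀ s j, j < s.1.2 → N s j = 0 := fun s j hj =>
    h.apply_eq_zero (not_schubertDAG_adj_inr · s) <| by
      simp [reflTransGen_schubertDAG_iff, schubertDAG_adj_inr_inl_inr, hj]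
  obtain ⟨T, T_upper, T_inv⟩ := exists_blockTriangular_one_sub_mul_eq_one L_eq_zero
  have MT_eq_zero : ∀ s j, j < s.1.1 → (M * T) s j = 0 := by
    intro s j hj
    rw [mul_apply]
    refine Finset.sum_eq_zero fun k _ => ?_
    obtain hk | hk := lt_or_ge k s.1.1
    · exact mul_eq_zero_of_left (M_eq_zero s k hk) _
    · exact mul_eq_zero_of_right _ (T_upper (hj.trans_le hk))
  have Q_eq : Q = (M * T)ᵀ * N :=
    calc
      Q = ((1 - L) * T)ᵀ * Q := by rw [T_inv, transpose_one, Matrix.one_mul]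
      _ = Tᵀ * (Q - Lᵀ * Q) := by
        rw [transpose_mul, transpose_sub, transpose_one, Matrix.mul_assoc, Matrix.sub_mul,
          Matrix.one_mul]
      _ = Tᵀ * (Mᵀ * N) := congrArg _ (sub_eq_of_eq_add' (cross_eq_of_isStructural h))
      _ = (M * T)ᵀ * N := by rw [transpose_mul, Matrix.mul_assoc]
  exact (mem_triangularOrbit_iff hw).2
    ⟨M * T, N, MT_eq_zero, N_eq_zero, fun i j => congrFun₂ Q_eq i j⟩

open Classical in
theorem mem_observedCovariances_of_det_ne_zero {z : Sym2 (Observed n) → ℂ}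
    {U : Matrix (Ones w) (Observed n) ℂ}
    (hU : ∀ s x, ¬ (schubertDAG w).Adj (.inr s) (.inl x) → U s x = 0)
    {A : Matrix (Observed n) (Observed n) ℂ} (hA : ∀ x y, z s(x, y) = (A + Uᵀ * U) x y)
    (hcross : ∀ i j, A (.inl i) (.inr j) = 0)
    (hdet : ∀ y, (A.submatrix (Subtype.val : {x // x < y} → Observed n) Subtype.val).det ≠ 0) :
    z ∈ (schubertDAG w).observedCovariances Embedding.inl := by
  obtain ⟨L, L_eq_zero, L_eq⟩ := exists_transpose_mul_apply_eq A hdet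
  have isSymm_A : A.IsSymm := by
    have isSymm_sum : (A + Uᵀ * U).IsSymm := .ext fun x y => by rw [← hA, ← hA, Sym2.eq_swap]
    simpa only [add_sub_cancel_right] using isSymm_sum.sub (transpose_mul Uᵀ U)
  have A_eq : ∀ x y, ¬ ReflTransGen (schubertDAG w).Adj (.inl x) (.inl y) →
      A x y = (Lᵀ * A) x y := by
    have cross_eq : ∀ {x y : Observed n}, x.isLeft ≠ y.isLeft → A x y = 0 := by
      rintro (i | i) (j | j) h
      exacts [absurd rfl h, hcross i j, (isSymm_A.apply _ _).trans (hcross j i), absurd rfl h]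
    intro x y hxy
    rw [reflTransGen_schubertDAG_iff, schubertDAG_adj_inl_inl, not_or] at hxy
    by_cases side : x.isLeft = y.isLeft
    · have hyx : y < x := by
        rcases x with i | i <;> rcases y with j | j <;>
          grind [Sum.inl_lt_inl_iff, Sum.inr_lt_inr_iff]
      exact (L_eq y x hyx).symm
    · rw [cross_eq side, mul_apply]
      refine (Finset.sum_eq_zero fun k _ => ?_).symm
      by_cases hkx : k.isLeft = x.isLeft
      · rw [cross_eq (hkx ▸ side), mul_zero]
      · have not_lt : ¬ k < x := by rintro (h | h) <;> exact hkx rfl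
        rw [transpose_apply, L_eq_zero k x not_lt, zero_mul]
  obtain ⟨θ, hθ⟩ := (isStructural_fromBlocks
    (fun x y hxy => L_eq_zero x y (mt schubertDAG_adj_inl_inl.2 hxy)) hU isSymm_A
    A_eq).exists_covariance_eq
  exact ⟨θ, fun x y => by rw [hA, hθ]; rfl⟩

theorem observedCovariances_subset_triangularOrbit (hw : IsPartialPermutation w) :
    (schubertDAG w).observedCovariances Embedding.inl ⊆
      {z | (fun p => z s(.inl p.1, .inr p.2)) ∈ triangularOrbit w} := by
  rintro z ⟨θ, hθ⟩
  simp only [Set.mem_ofPred_eq, hθ]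
  exact mem_triangularOrbit_of_isStructural hw (isStructural_covariance θ)

theorem triangularOrbit_subset_closure_observedCovariances (hw : IsPartialPermutation w) :
    {z | (fun p => z s(.inl p.1, .inr p.2)) ∈ triangularOrbit w} ⊆
      closure ((schubertDAG w).observedCovariances Embedding.inl) := by
  classical
  intro z hz
  rw [Set.mem_ofPred_eq, mem_triangularOrbit_iff hw] at hz
  obtain ⟨M, N, hM, hN, hMN⟩ := hz
  let U : Matrix (Ones w) (Observed n) ℂ := fromCols M N
  have U_eq_zero : ∀ s x, ¬ (schubertDAG w).Adj (.inr s) (.inl x) → U s x = 0 := by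
    rintro s (k | k) h
    · exact hM s k (not_le.1 (mt schubertDAG_adj_inr_inl_inl.2 h))
    · exact hN s k (not_le.1 (mt schubertDAG_adj_inr_inl_inr.2 h))
  let A : Matrix (Observed n) (Observed n) ℂ := .of (fun x y => z s(x, y)) - Uᵀ * U
  let path (t : ℂ) (e : Sym2 (Observed n)) : ℂ := z e + t * if e.IsDiag then 1 else 0
  have path_zero : path 0 = z := by simp [path]
  have continuous_path : Continuous path := by fun_prop
  refine mem_closure_of_tendsto (b := 𝓝[≠] 0)
    (path_zero ▸ (continuous_path.tendsto 0).mono_left nhdsWithin_le_nhds) ?_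
  filter_upwards [eventually_all.2 fun x : Observed n => eventually_det_add_smul_one_ne_zero
    (A.submatrix (Subtype.val : {k // k < x} → Observed n) Subtype.val)] with t ht
  refine mem_observedCovariances_of_det_ne_zero (A := A + t • 1) U_eq_zero (fun x y => ?_)
    (fun i j => ?_) fun x => ?_
  · simp [A, path, one_apply, sub_add_eq_add_sub]
  · simp [A, hMN i j, U, mul_apply]
  · simpa only [submatrix_add, submatrix_smul, Pi.add_apply, Pi.smul_apply,
      submatrix_one _ Subtype.val_injective] using ht x

end SchubertDAG

theorem mainTheorem7 (n : ℕ) (w : Matrix (Fin n) (Fin n) ℂ) (hw : IsPartialPermutation w) :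
    (schubertIdeal w).map (crossInclusion n) =
      (schubertDAG w).hiddenIdeal (O := Observed n) Function.Embedding.inl := by
  rw [map_schubertIdeal_eq_vanishingIdeal, DAG.hiddenIdeal_eq_vanishingIdeal]
  exact (vanishingIdeal_eq_of_subset_of_subset_closure
    (observedCovariances_subset_triangularOrbit hw)
    (triangularOrbit_subset_closure_observedCovariances hw)).symm
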